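/- For $n\in\mathbb N$ let $f_n$ denote the number of total preorders on an $n$-element set (orderings with possible ties). Let $k\ge 3$ be an integer and put $$R_k=\left\lceil 2+\frac{k}{k-1}\sqrt[k]{8k(k-1)f_k}\,\right\rceil .$$ Let $G=(V,E)$ be a finite simple $k$-regular graph in which every vertex and every edge $x$ is assigned a finite list (set) $L_x$ of available labels with $|L_x|\ge R_k$. Then there is a total labeling $\eta$ of $G$, that is, a function on $V\cup E$, with $\eta(x)\in L_x$ for every $x\in V\cup E$, which distinguishes neighbors by sets: writing $E(v)$ for the set of edges incident to $v$, for any two adjacent vertices $u,v$ we have $$\eta(E(u)\cup\{u\})\neq\eta(E(v)\cup\{v\}).$$ Moreover, if $k\ge 1600$, then $R_k\le 0.54\,k$. -/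

import Mathlib

/-- The number `f_n` of total preorders on an `n`-element set (orderings with possible ties);
the `n`-th Fubini number, or ordered Bell number. -/
noncomputable def fubiniNumber (n : ℕ) : ℕ :=
  Nat.card {r : Fin n → Fin n → Prop //
    (∀ a b, r a b ∨ r b a) ∧ (∀ a b c, r a b → r b c → r a c)}

/-- The list size `⌈2 + (k / (k - 1)) * (8 k (k - 1) f_k) ^ (1 / k)⌉`, computed in the reals. -/
noncomputable def totalListSize (k : ℕ) : ℕ :=
  ⌈2 + (k : ℝ) / ((k : ℝ) - 1) *
    (8 * (k : ℝ) * ((k : ℝ) - 1) * (fubiniNumber k : ℝ)) ^ (1 / (k : ℝ))⌉₊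

namespace SimpleGraph

variable {V : Type*} (G : SimpleGraph V)

/-- `E(v) ∪ {v}`: the vertex `v` together with all edges of `G` incident to `v`, as a subset of
the disjoint union of the vertex set and the edge set. -/
def totalStar (v : V) : Set (V ⊕ G.edgeSet) :=
  {Sum.inl v} ∪ Sum.inr '' {e : G.edgeSet | v ∈ (e : Sym2 V)}

/-- A total labeling `η` (a labeling of vertices and edges) distinguishes neighbors by sets:
adjacent vertices `u`, `v` have different label sets `η(E(u) ∪ {u}) ≠ η(E(v) ∪ {v})`. -/
def TotalDistinguishesBySets {α : Type*} (η : V ⊕ G.edgeSet → α) : Prop :=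
  ∀ u v : V, G.Adj u v → η '' G.totalStar u ≠ η '' G.totalStar v

end SimpleGraph

/-! Call an edge uv bad if the label sets of u and v coincide. The total stars of u and v share only
uv, so once the labels outside W = (E(v) ∪ {v}) \ {uv} are fixed, the label set T of u is known, and
the k elements of W must map onto T or onto T without the label of uv. Pulling back a linear order
on labels turns such a map into a total preorder on W from which it can be recovered, so at most f_k
of the R^k labelings of W make uv bad (`card_le_of_image_totalStarFinset_eq`).

Rosenfeld's counting (`exists_choice_avoiding`) turns this into existence: imposing the constraints
one coordinate at a time keeps at least the proportion q = (k-1)/k of the labelings. A coordinate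
lies in the support of at most 2k events, each destroying at most the proportion f_k/(Rq)^k ≤
1/(8k(k-1)), and 2k/(8k(k-1)) ≤ 1/k = 1 - q.

For large k, f_k ≤ (3/4) k!/(log 2)^k and Stirling's bound make the k-th root about k/(e log 2) ≈
0.5307 k. -/

/-! ### Maps with prescribed image and total preorders -/

/-- The total preorders on a type. -/
abbrev TotalPreorderOn (β : Type*) :=
  {r : β → β → Prop // (∀ a b, r a b ∨ r b a) ∧ (∀ a b c, r a b → r b c → r a c)}

/-- Transport of total preorders along an equivalence. -/
def TotalPreorderOn.congr {β γ : Type*} (e : β ≃ γ) : TotalPreorderOn β ≃ TotalPreorderOn γ where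
  toFun r := ⟨fun a b => r.1 (e.symm a) (e.symm b),
    fun _ _ => r.2.1 _ _, fun _ _ _ h h' => r.2.2 _ _ _ h h'⟩
  invFun r := ⟨fun a b => r.1 (e a) (e b),
    fun _ _ => r.2.1 _ _, fun _ _ _ h h' => r.2.2 _ _ _ h h'⟩
  left_inv r := by ext; simp
  right_inv r := by ext; simp

theorem natCard_totalPreorderOn (β : Type*) [Fintype β] :
    Nat.card (TotalPreorderOn β) = fubiniNumber (Fintype.card β) :=
  Nat.card_congr (TotalPreorderOn.congr (Fintype.equivFin β))

theorem Finset.card_image_le_of_eq_imp {ι α β : Type*} [DecidableEq α] [DecidableEq β]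
    (B : Finset ι) (φ : ι → α) (ψ : ι → β) (h : ∀ a b, φ a = φ b → ψ a = ψ b) :
    (B.image ψ).card ≤ (B.image φ).card := by
  refine Finset.card_le_card_of_forall_subsingleton (fun y x => ∃ b ∈ B, ψ b = y ∧ φ b = x)
    ?_ ?_
  · intro y hy
    obtain ⟨b, hb, rfl⟩ := Finset.mem_image.1 hy
    exact ⟨φ b, Finset.mem_image_of_mem _ hb, b, hb, rfl, rfl⟩
  · rintro x - y ⟨-, b, -, rfl, hb⟩ y' ⟨-, b', -, rfl, hb'⟩
    exact h _ _ (hb.trans hb'.symm)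

/-- The preorder determines how many values lie below the value at `a`; this rank singles out one
element of the common range. -/
theorem eq_of_le_iff_le_of_range_eq {ι α : Type*} [Fintype ι] [LinearOrder α] (φ ψ : ι → α)
    (h : ∀ a b, φ a ≤ φ b ↔ ψ a ≤ ψ b)
    (hr : Set.range φ = Set.range ψ) : φ = ψ := by
  have hT : Finset.univ.image φ = Finset.univ.image ψ := by
    rw [← Finset.coe_inj]
    simpa using hr
  have hlt : ∀ a b, φ a < φ b ↔ ψ a < ψ b := fun a b => by
    rw [← not_le, ← not_le, h]
  have heq : ∀ a b, φ a = φ b ↔ ψ a = ψ b := fun a b => by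
    rw [le_antisymm_iff, le_antisymm_iff, h, h]
  have himg : ∀ (χ : ι → α) (a : ι), (Finset.univ.image χ).filter (· < χ a) =
      (Finset.univ.filter fun b => χ b < χ a).image χ := by
    intro χ a
    ext x
    simp only [Finset.mem_filter, Finset.mem_image, Finset.mem_univ, true_and]
    constructor
    · rintro ⟨⟨b, rfl⟩, hb⟩
      exact ⟨b, hb, rfl⟩
    · rintro ⟨b, hb, rfl⟩
      exact ⟨⟨b, rfl⟩, hb⟩
  have hcard : ∀ a, ((Finset.univ.image φ).filter (· < φ a)).card =
      ((Finset.univ.image φ).filter (· < ψ a)).card := by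
    intro a
    rw [himg φ a, hT, himg ψ a]
    simp only [hlt]
    exact le_antisymm (Finset.card_image_le_of_eq_imp _ _ _ fun a b => (heq a b).2)
      (Finset.card_image_le_of_eq_imp _ _ _ fun a b => (heq a b).1)
  have key : ∀ x y, x ∈ Finset.univ.image φ → x < y →
      ((Finset.univ.image φ).filter (· < x)).card <
      ((Finset.univ.image φ).filter (· < y)).card := by
    intro x y hx hxy
    apply Finset.card_lt_card
    refine (Finset.ssubset_iff_of_subset ?_).2
      ⟨x, Finset.mem_filter.2 ⟨hx, hxy⟩, fun h => lt_irrefl _ (Finset.mem_filter.1 h).2⟩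
    intro z hz
    exact Finset.mem_filter.2 ⟨(Finset.mem_filter.1 hz).1, (Finset.mem_filter.1 hz).2.trans hxy⟩
  funext a
  rcases lt_trichotomy (φ a) (ψ a) with hl | hl | hl
  · have := key _ _ (Finset.mem_image_of_mem _ (Finset.mem_univ a)) hl
    have := hcard a
    omega
  · exact hl
  · have := key _ _ (by rw [hT]; exact Finset.mem_image_of_mem _ (Finset.mem_univ a)) hl
    have := hcard a
    omega

/-- The maps from `ι` onto `T` or onto `T` minus a fixed point are at most as many as the total
preorders on `ι`: pull back a linear order of the target. -/
theorem card_le_fubiniNumber_of_image {ι α : Type*} [Fintype ι] [DecidableEq α]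
    (T : Finset α) (t : α) (ht : t ∈ T) (s : Finset (ι → α))
    (hs : ∀ φ ∈ s, Finset.univ.image φ = T ∨ Finset.univ.image φ = T.erase t) :
    s.card ≤ fubiniNumber (Fintype.card ι) := by
  classical
  -- Equal fibres force equally many values, and `T` and `T.erase t` differ in size, so the preorder
  -- also decides which of the two is the image.
  have key : ∀ φ ∈ s, ∀ ψ ∈ s, (∀ a b, φ a = φ b ↔ ψ a = ψ b) →
      Set.range φ = Set.range ψ := by
    intro φ hφ ψ hψ heq
    have hc : (Finset.univ.image φ).card = (Finset.univ.image ψ).card :=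
      le_antisymm (Finset.card_image_le_of_eq_imp _ _ _ fun a b => (heq a b).2)
        (Finset.card_image_le_of_eq_imp _ _ _ fun a b => (heq a b).1)
    have hlt := Finset.card_erase_lt_of_mem ht
    have : Finset.univ.image φ = Finset.univ.image ψ := by
      rcases hs φ hφ with h1 | h1 <;> rcases hs ψ hψ with h2 | h2 <;> rw [h1, h2] at hc <;>
        first | omega | exact h1.trans h2.symm
    simpa using congrArg (fun u : Finset α => (u : Set α)) this
  let _ : LinearOrder α := linearOrderOfSTO (WellOrderingRel (α := α))
  let _ : Fintype (TotalPreorderOn ι) := Fintype.ofFinite _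
  rw [← natCard_totalPreorderOn, Nat.card_eq_fintype_card, ← Finset.card_univ]
  refine Finset.card_le_card_of_injOn
    (fun φ => ⟨fun a b => φ a ≤ φ b, fun _ _ => le_total _ _, fun _ _ _ h h' => h.trans h'⟩)
    (fun _ _ => Finset.mem_univ _) ?_
  intro φ hφ ψ hψ h
  have h : ∀ a b, φ a ≤ φ b ↔ ψ a ≤ ψ b := fun a b =>
    iff_of_eq (congrFun (congrFun (Subtype.ext_iff.1 h) a) b)
  exact eq_of_le_iff_le_of_range_eq φ ψ h (key φ hφ ψ hψ fun a b => by
    rw [le_antisymm_iff, le_antisymm_iff, h, h])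

/-! ### Recursion for the Fubini numbers -/

theorem fubiniNumber_zero_le : fubiniNumber 0 ≤ 1 := by
  unfold fubiniNumber
  rw [Finite.card_le_one_iff_subsingleton]
  exact ⟨fun a b => Subtype.ext (funext fun x => x.elim0)⟩

/-- Splitting off the class of minimal elements of a total preorder. -/
theorem fubiniNumber_le_sum (n : ℕ) (hn : 0 < n) :
    fubiniNumber n ≤ ∑ j ∈ Finset.range n, n.choose j * fubiniNumber j := by
  classical
  have : Nonempty (Fin n) := ⟨⟨0, hn⟩⟩
  -- The complement of the minimal class; `r` is determined by this set and its restriction to it.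
  let U : TotalPreorderOn (Fin n) → Finset (Fin n) := fun r =>
    Finset.univ.filter fun a => ∃ b, ¬ r.1 a b
  have hU : ∀ r a, a ∉ U r ↔ ∀ b, r.1 a b := fun r a => by simp [U]
  have hne : ∀ r, U r ≠ Finset.univ := by
    intro r hr
    obtain ⟨z, hz⟩ : ∃ z, ∀ b, r.1 z b := by
      have : IsTrans (Fin n) fun a b => r.1 b a := ⟨fun a b c h h' => r.2.2 _ _ _ h' h⟩
      have hd : Directed (fun a b => r.1 b a) (id : Fin n → Fin n) := fun a b => by
        rcases r.2.1 a b with h | h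
        · exact ⟨a, (r.2.1 a a).elim id id, h⟩
        · exact ⟨b, h, (r.2.1 b b).elim id id⟩
      simpa using hd.finite_le (g := id)
    have : z ∉ U r := (hU r z).2 hz
    rw [hr] at this
    exact this (Finset.mem_univ _)
  let _ : Fintype (TotalPreorderOn (Fin n)) := Fintype.ofFinite _
  have h1 : fubiniNumber n = (Finset.univ : Finset (TotalPreorderOn (Fin n))).card := by
    rw [Finset.card_univ, ← Nat.card_eq_fintype_card]; rfl
  -- The value 0 at `n` accounts for the full set, which never occurs as `U r` but does occur in the
  -- sum over all subsets.
  let g : ℕ → ℕ := fun m => if m < n then fubiniNumber m else 0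
  have h2 : ∀ W : Finset (Fin n),
      (Finset.univ.filter fun r : TotalPreorderOn (Fin n) => U r = W).card ≤ g W.card := by
    intro W
    by_cases hW : W = Finset.univ
    · rw [Finset.card_eq_zero.2]
      · exact Nat.zero_le _
      · exact Finset.filter_eq_empty_iff.2 fun r _ h => hne r (h.trans hW)
    have hlt : W.card < n := by
      have := (Finset.card_lt_iff_ne_univ W).2 hW
      simpa using this
    simp only [g, if_pos hlt]
    let _ : Fintype (TotalPreorderOn W) := Fintype.ofFinite _
    have := natCard_totalPreorderOn W
    rw [Fintype.card_coe] at this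
    rw [← this, Nat.card_eq_fintype_card, ← Finset.card_univ]
    refine Finset.card_le_card_of_injOn
      (fun r => ⟨fun a b => r.1 a b, fun _ _ => r.2.1 _ _, fun _ _ _ h h' => r.2.2 _ _ _ h h'⟩)
      (fun _ _ => Finset.mem_univ _) ?_
    intro r hr r' hr' h
    have hr : U r = W := by simpa using hr
    have hr' : U r' = W := by simpa using hr'
    have h : ∀ a b (ha : a ∈ W) (hb : b ∈ W), r.1 a b ↔ r'.1 a b := fun a b ha hb =>
      iff_of_eq (congrFun (congrFun (Subtype.ext_iff.1 h) ⟨a, ha⟩) ⟨b, hb⟩)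
    refine Subtype.ext (funext fun a => funext fun b => propext ?_)
    -- An element outside `W` is below everything, while an element of `W` is never below one
    -- outside, since it would then be minimal too.
    by_cases ha : a ∈ W
    · by_cases hb : b ∈ W
      · exact h a b ha hb
      · have key : ∀ r, U r = W → ¬ r.1 a b := by
          intro r hr hab
          have hb' := (hU r b).1 (hr ▸ hb)
          exact (hU r a).2 (fun c => r.2.2 _ _ _ hab (hb' c)) (hr ▸ ha)
        exact iff_of_false (key r hr) (key r' hr')
    · exact iff_of_true ((hU r a).1 (hr ▸ ha) b) ((hU r' a).1 (hr' ▸ ha) b)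
  calc fubiniNumber n = ∑ W : Finset (Fin n),
        (Finset.univ.filter fun r : TotalPreorderOn (Fin n) => U r = W).card := by
        rw [h1]; exact Finset.card_eq_sum_card_fiberwise fun _ _ => Finset.mem_univ _
    _ ≤ ∑ W ∈ (Finset.univ : Finset (Fin n)).powerset, g W.card := by
        rw [Finset.powerset_univ]; exact Finset.sum_le_sum fun W _ => h2 W
    _ = ∑ j ∈ Finset.range n, n.choose j * fubiniNumber j := by
        rw [Finset.sum_powerset_apply_card, Finset.card_univ, Fintype.card_fin,
          Finset.sum_range_succ]
        have hg : g n = 0 := if_neg (lt_irrefl n)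
        rw [hg, smul_zero, add_zero]
        refine Finset.sum_congr rfl fun j hj => ?_
        rw [smul_eq_mul, show g j = fubiniNumber j from if_pos (Finset.mem_range.1 hj)]

/-! ### Rosenfeld's counting argument -/

/-- The choices from lists for which no bad event supported in `S` occurs. -/
noncomputable def goodChoices {X α ι : Type*} [Fintype X] (L : X → Finset α)
    (supp : ι → Finset X) (bad : ι → (X → α) → Prop) (S : Finset X) : Finset (X → α) :=
  by classical exact
    (Fintype.piFinset L).filter fun η => ∀ e, supp e ⊆ S → ¬ bad e η

theorem mem_goodChoices {X α ι : Type*} [Fintype X] {L : X → Finset α}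
    {supp : ι → Finset X} {bad : ι → (X → α) → Prop} {S : Finset X} {η : X → α} :
    η ∈ goodChoices L supp bad S ↔ (∀ x, η x ∈ L x) ∧ ∀ e, supp e ⊆ S → ¬ bad e η := by
  simp [goodChoices]

open Classical in
/-- If membership in `A` does not depend on the coordinates in `W` and at most `F` of the
`R ^ #W` ways to choose these coordinates satisfy `p`, then `p` holds on at most a proportion
`F / R ^ #W` of `A`. -/
theorem card_filter_mul_pow_le {X α : Type*} [Fintype X] [DecidableEq X] {L : X → Finset α} {R F : ℕ}
    (hL : ∀ x, (L x).card = R) (A : Finset (X → α)) (hA : ∀ η ∈ A, ∀ x, η x ∈ L x)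
    (W : Finset X) (hW : ∀ η ∈ A, ∀ η', (∀ x, η' x ∈ L x) → (∀ x ∉ W, η' x = η x) → η' ∈ A)
    (p : (X → α) → Prop)
    (hF : ∀ (η₀ : X → α) (s : Finset (X → α)),
      (∀ η ∈ s, (∀ x ∉ W, η x = η₀ x) ∧ p η) → s.card ≤ F) :
    (A.filter p).card * R ^ W.card ≤ F * A.card := by
  let ρ : (X → α) → ({x // x ∉ W} → α) := fun η x => η x
  have hρ : ∀ η η', ρ η = ρ η' ↔ ∀ x ∉ W, η x = η' x := fun η η' => by
    simp [ρ, funext_iff]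
  have h1 : (A.filter p).card ≤ F * (A.image ρ).card := by
    refine Finset.card_le_mul_card_image_of_maps_to
      (fun η hη => Finset.mem_image_of_mem ρ (Finset.mem_filter.1 hη).1) F ?_
    intro b hb
    obtain ⟨η₀, h₀, rfl⟩ := Finset.mem_image.1 hb
    refine hF η₀ _ fun η hη => ?_
    simp only [Finset.mem_filter, hρ] at hη
    exact ⟨hη.2, hη.1.2⟩
  have h2 : R ^ W.card * (A.image ρ).card ≤ A.card := by
    refine Finset.mul_card_image_le_card _ _ ?_
    intro b hb
    obtain ⟨η₀, h₀, rfl⟩ := Finset.mem_image.1 hb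
    have : (Fintype.piFinset fun x => if x ∈ W then L x else {η₀ x}).card = R ^ W.card := by
      rw [Fintype.card_piFinset, ← Finset.prod_const, ← Finset.prod_subset (Finset.subset_univ W)]
      · exact Finset.prod_congr rfl fun x hx => by rw [if_pos hx, hL]
      · intro x _ hx
        simp [hx]
    rw [← this]
    refine Finset.card_le_card ?_
    intro η hη
    rw [Fintype.mem_piFinset] at hη
    have e : ∀ x ∉ W, η x = η₀ x := fun x hx => by simpa [hx] using hη x
    refine Finset.mem_filter.2 ⟨hW η₀ h₀ η ?_ e, (hρ _ _).2 e⟩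
    intro x
    by_cases hx : x ∈ W
    · simpa [hx] using hη x
    · rw [e x hx]; exact hA _ h₀ x
  calc _ ≤ F * (A.image ρ).card * R ^ W.card := Nat.mul_le_mul_right _ h1
    _ = F * (R ^ W.card * (A.image ρ).card) := by ring
    _ ≤ _ := Nat.mul_le_mul_left _ h2

/-- Rosenfeld's counting argument: list choices avoiding bad events. -/
theorem exists_choice_avoiding {X α ι : Type*} [Fintype X] [DecidableEq X] [Fintype ι]
    {L : X → Finset α} {R F : ℕ} (hR : 0 < R) (hL : ∀ x, (L x).card = R)
    (supp : ι → Finset X) (bad : ι → (X → α) → Prop)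
    (hsupp : ∀ e η η', (∀ x ∈ supp e, η x = η' x) → bad e η → bad e η')
    (hne : ∀ e, (supp e).Nonempty)
    (W : ι → Finset X) (hW : ∀ e, W e ⊆ supp e)
    (hF : ∀ (e : ι) (η₀ : X → α) (s : Finset (X → α)),
      (∀ η ∈ s, (∀ y ∉ W e, η y = η₀ y) ∧ bad e η) → s.card ≤ F)
    (q : ℝ) (hq : 0 < q)
    (hsum : ∀ x, ∑ e ∈ Finset.univ.filter (fun e => x ∈ supp e),
      (F : ℝ) / (R : ℝ) ^ (W e).card / q ^ ((W e).erase x).card ≤ 1 - q) :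
    ∃ η : X → α, (∀ x, η x ∈ L x) ∧ ∀ e, ¬ bad e η := by
  classical
  let C : Finset X → Finset (X → α) := goodChoices L supp bad
  have anti : ∀ S T, S ⊆ T → C T ⊆ C S := fun S T h η hη => by
    rw [mem_goodChoices] at hη ⊢
    exact ⟨hη.1, fun e he => hη.2 e (he.trans h)⟩
  -- Every member of `C S` labels all of `X`, with coordinates outside `S` unconstrained, so sizes
  -- compare as proportions and no factor `R` appears.
  have step : ∀ n, ∀ S : Finset X, S.card = n → ∀ x ∉ S,
      q * ((C S).card : ℝ) ≤ ((C (insert x S)).card : ℝ) := by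
    intro n
    induction n using Nat.strong_induction_on with
    | _ n ih =>
    intro S hS x hx
    have chain : ∀ D ⊆ S, q ^ D.card * ((C (S \ D)).card : ℝ) ≤ ((C S).card : ℝ) := by
      intro D
      induction D using Finset.induction_on with
      | empty => simp
      | insert a D ha ihD =>
        intro hD
        rw [Finset.insert_subset_iff] at hD
        refine le_trans ?_ (ihD hD.2)
        have e : insert a (S \ insert a D) = S \ D := by
          ext y
          simp only [Finset.mem_insert, Finset.mem_sdiff]
          by_cases hy : y = a
          · subst hy; simp [hD.1, ha]
          · simp [hy]
        have hlt : (S \ insert a D).card < n := by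
          rw [← hS]
          exact Finset.card_lt_card ((Finset.ssubset_iff_of_subset Finset.sdiff_subset).2
            ⟨a, hD.1, by simp⟩)
        have := ih _ hlt (S \ insert a D) rfl a (by simp)
        rw [e] at this
        rw [Finset.card_insert_of_notMem ha, pow_succ, mul_assoc]
        gcongr
    -- Since `x ∉ S`, removing `(W e).erase x` from `S` frees all of `W e`; there the event has
    -- proportion at most `F / R ^ #W`. By `chain`, returning to `S` costs one factor `1 / q` per
    -- removed coordinate.
    have hbad : ∀ e, supp e ⊆ insert x S → (((C S).filter (bad e)).card : ℝ) ≤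
        (F : ℝ) / (R : ℝ) ^ (W e).card / q ^ ((W e).erase x).card * (C S).card := by
      intro e hes
      have hsub : (W e).erase x ⊆ S := by
        intro y hy
        rw [Finset.mem_erase] at hy
        exact (Finset.mem_insert.1 (hes (hW e hy.2))).resolve_left hy.1
      have h1 := chain _ hsub
      have h2 := card_filter_mul_pow_le hL (C (S \ (W e).erase x))
        (fun η hη => (mem_goodChoices.1 hη).1) (W e) (by
          intro η hη η' hη' h
          rw [mem_goodChoices] at hη ⊢
          refine ⟨hη', fun e' he' hb => hη.2 e' he' (hsupp e' η' η ?_ hb)⟩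
          intro y hy
          apply h
          intro hyW
          have hyS := Finset.mem_sdiff.1 (he' hy)
          by_cases hyx : y = x
          · exact hx (hyx ▸ hyS.1)
          · exact hyS.2 (Finset.mem_erase.2 ⟨hyx, hyW⟩)) (bad e) (hF e)
      have h3 : ((C S).filter (bad e)).card ≤
          ((C (S \ (W e).erase x)).filter (bad e)).card :=
        Finset.card_le_card (Finset.filter_subset_filter _ (anti _ _ Finset.sdiff_subset))
      have hRp : (0 : ℝ) < (R : ℝ) ^ (W e).card := by positivity
      have hqp : 0 < q ^ ((W e).erase x).card := by positivity
      have h4 : (((C S).filter (bad e)).card : ℝ) * (R : ℝ) ^ (W e).card ≤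
          F * (C (S \ (W e).erase x)).card := by
        refine le_trans (mul_le_mul_of_nonneg_right (Nat.cast_le.2 h3) hRp.le) ?_
        exact_mod_cast h2
      rw [div_div, div_mul_eq_mul_div, le_div_iff₀ (by positivity)]
      calc _ = (((C S).filter (bad e)).card : ℝ) * (R : ℝ) ^ (W e).card *
            q ^ ((W e).erase x).card := by ring
        _ ≤ F * (C (S \ (W e).erase x)).card * q ^ ((W e).erase x).card := by gcongr
        _ = F * (q ^ ((W e).erase x).card * (C (S \ (W e).erase x)).card) := by ring
        _ ≤ _ := by gcongr
    -- Only events whose support contains `x` are new constraints.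
    have hcover : C S ⊆ C (insert x S) ∪
        (Finset.univ.filter fun e => x ∈ supp e ∧ supp e ⊆ insert x S).biUnion
          fun e => (C S).filter (bad e) := by
      intro η hη
      by_contra hcon
      simp only [Finset.mem_union, Finset.mem_biUnion, Finset.mem_filter, Finset.mem_univ,
        true_and, not_or, not_exists, not_and] at hcon
      refine hcon.1 (mem_goodChoices.2 ⟨(mem_goodChoices.1 hη).1, fun e he hb => ?_⟩)
      by_cases hxe : x ∈ supp e
      · exact hcon.2 e ⟨hxe, he⟩ hη hb
      · exact (mem_goodChoices.1 hη).2 e ((Finset.subset_insert_iff_of_notMem hxe).1 he) hb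
    have hcount : ((C S).card : ℝ) ≤ (C (insert x S)).card + (1 - q) * (C S).card := by
      calc ((C S).card : ℝ) ≤ (C (insert x S)).card +
            ∑ e ∈ Finset.univ.filter (fun e => x ∈ supp e ∧ supp e ⊆ insert x S),
              (((C S).filter (bad e)).card : ℝ) := by
            exact_mod_cast (Finset.card_le_card hcover).trans
              ((Finset.card_union_le _ _).trans (Nat.add_le_add_left Finset.card_biUnion_le _))
        _ ≤ (C (insert x S)).card +
            ∑ e ∈ Finset.univ.filter (fun e => x ∈ supp e ∧ supp e ⊆ insert x S),
              (F : ℝ) / (R : ℝ) ^ (W e).card / q ^ ((W e).erase x).card * (C S).card := by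
            gcongr with e he
            have he := (Finset.mem_filter.1 he).2
            exact hbad e he.2
        _ ≤ (C (insert x S)).card +
            ∑ e ∈ Finset.univ.filter (fun e => x ∈ supp e),
              (F : ℝ) / (R : ℝ) ^ (W e).card / q ^ ((W e).erase x).card * (C S).card := by
            gcongr with e he
            exact fun h => h.1
        _ ≤ _ := by
            rw [← Finset.sum_mul]
            gcongr
            exact hsum x
    linarith
  have hpos : ∀ S : Finset X, 0 < (C S).card := by
    intro S
    induction S using Finset.induction_on with
    | empty =>
      have : (Fintype.piFinset L).Nonempty := by
        rw [Fintype.piFinset_nonempty]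
        exact fun x => Finset.card_pos.1 (hL x ▸ hR)
      obtain ⟨η, hη⟩ := this
      refine Finset.card_pos.2 ⟨η, mem_goodChoices.2 ⟨Fintype.mem_piFinset.1 hη, fun e he => ?_⟩⟩
      exact absurd (Finset.subset_empty.1 he) (hne e).ne_empty
    | insert a S ha ihS =>
      have h := step _ S rfl a ha
      have : (0 : ℝ) < (C (insert a S)).card :=
        lt_of_lt_of_le (mul_pos hq (Nat.cast_pos.2 ihS)) h
      exact_mod_cast this
  obtain ⟨η, hη⟩ := Finset.card_pos.1 (hpos Finset.univ)
  rw [mem_goodChoices] at hη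
  exact ⟨η, hη.1, fun e => hη.2 e (Finset.subset_univ _)⟩

/-! ### Total stars and the bad events of edges -/

namespace SimpleGraph

variable {V : Type*} [Fintype V] (G : SimpleGraph V) [DecidableRel G.Adj]

open Classical in
/-- The total star of a vertex as a finset. -/
noncomputable def totalStarFinset (v : V) : Finset (V ⊕ G.edgeSet) :=
  Finset.univ.filter (· ∈ G.totalStar v)

theorem coe_totalStarFinset (v : V) : (G.totalStarFinset v : Set _) = G.totalStar v := by
  ext; simp [totalStarFinset]

theorem inl_mem_totalStarFinset {v w : V} :
    Sum.inl w ∈ G.totalStarFinset v ↔ w = v := by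
  rw [← Finset.mem_coe, coe_totalStarFinset]
  simp [totalStar]

theorem inr_mem_totalStarFinset {v : V} {e : G.edgeSet} :
    Sum.inr e ∈ G.totalStarFinset v ↔ v ∈ (e : Sym2 V) := by
  rw [← Finset.mem_coe, coe_totalStarFinset]
  simp [totalStar]

open Classical in
theorem card_filter_mem_edge (v : V) :
    (Finset.univ.filter fun e : G.edgeSet => v ∈ (e : Sym2 V)).card = G.degree v := by
  rw [← G.card_incidenceFinset_eq_degree v, ← Finset.card_map (Function.Embedding.subtype _)]
  congr 1
  ext e
  simp [incidenceSet, and_comm]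

theorem card_totalStarFinset (v : V) : (G.totalStarFinset v).card = G.degree v + 1 := by
  classical
  have : G.totalStarFinset v = insert (Sum.inl v)
      ((Finset.univ.filter fun e : G.edgeSet => v ∈ (e : Sym2 V)).map Function.Embedding.inr) := by
    ext x
    rcases x with w | e
    · simp [inl_mem_totalStarFinset]
    · simp [inr_mem_totalStarFinset]
  rw [this, Finset.card_insert_of_notMem (by simp), Finset.card_map, card_filter_mem_edge]

/-- Hence relabeling the star of `v` away from the edge leaves every label on the star of `u`
unchanged. -/
theorem eq_edge_of_mem_totalStarFinset {u v : V} {e : G.edgeSet} (he : (e : Sym2 V) = s(u, v))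
    {x : V ⊕ G.edgeSet} (hu : x ∈ G.totalStarFinset u) (hv : x ∈ G.totalStarFinset v) :
    x = Sum.inr e := by
  have hadj : G.Adj u v := by
    have := e.2
    rwa [he, mem_edgeSet] at this
  rcases x with w | e'
  · rw [inl_mem_totalStarFinset] at hu hv
    exact absurd (hu.symm.trans hv) hadj.ne
  · rw [inr_mem_totalStarFinset] at hu hv
    congr 1
    exact Subtype.ext (((Sym2.mem_and_mem_iff hadj.ne).1 ⟨hu, hv⟩).trans he.symm)

open Classical in
/-- Given the labels outside `(E(v) ∪ {v}) \ {uv}`, there are at most `f_{deg v}` ways to make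
the label sets of `u` and `v` coincide. -/
theorem card_le_of_image_totalStarFinset_eq {α : Type*} {u v : V} {e : G.edgeSet} (he : (e : Sym2 V) = s(u, v)) (η₀ : V ⊕ G.edgeSet → α)
    (s : Finset (V ⊕ G.edgeSet → α)) (hs : ∀ η ∈ s,
      (∀ y ∉ (G.totalStarFinset v).erase (Sum.inr e), η y = η₀ y) ∧
      (G.totalStarFinset u).image η = (G.totalStarFinset v).image η) :
    s.card ≤ fubiniNumber (G.degree v) := by
  set W := (G.totalStarFinset v).erase (Sum.inr e) with hW
  have hev : Sum.inr e ∈ G.totalStarFinset v := by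
    rw [inr_mem_totalStarFinset, he]; exact Sym2.mem_mk_right u v
  have heu : Sum.inr e ∈ G.totalStarFinset u := by
    rw [inr_mem_totalStarFinset, he]; exact Sym2.mem_mk_left u v
  have hWc : Fintype.card W = G.degree v := by
    rw [Fintype.card_coe, hW, Finset.card_erase_of_mem hev, card_totalStarFinset,
      Nat.add_sub_cancel]
  rw [← hWc]
  let ρ : (V ⊕ G.edgeSet → α) → (W → α) := fun η x => η x
  rw [← Finset.card_image_of_injOn (f := ρ)]
  · refine card_le_fubiniNumber_of_image ((G.totalStarFinset u).image η₀) (η₀ (Sum.inr e))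
      (Finset.mem_image_of_mem _ heu) _ ?_
    intro φ hφ
    obtain ⟨η, hη, rfl⟩ := Finset.mem_image.1 hφ
    obtain ⟨hoff, heq⟩ := hs η hη
    have h1 : (G.totalStarFinset u).image η = (G.totalStarFinset u).image η₀ := by
      refine Finset.image_congr fun x hx => hoff x fun hx' => ?_
      rw [hW, Finset.mem_erase] at hx'
      exact hx'.1 (G.eq_edge_of_mem_totalStarFinset he hx hx'.2)
    have h2 : Finset.univ.image (ρ η) = W.image η := by
      ext y
      simp [ρ]
    have h3 : insert (η₀ (Sum.inr e)) (W.image η) = (G.totalStarFinset u).image η₀ := by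
      rw [← h1, heq, ← hoff (Sum.inr e) (by simp [hW]), ← Finset.image_insert, hW,
        Finset.insert_erase hev]
    rw [h2, ← h3]
    by_cases ht : η₀ (Sum.inr e) ∈ W.image η
    · left; rw [Finset.insert_eq_of_mem ht]
    · right; rw [Finset.erase_insert ht]
  · intro η hη η' hη' h
    have hη := (hs η hη).1
    have hη' := (hs η' hη').1
    funext x
    by_cases hx : x ∈ W
    · exact congrFun h ⟨x, hx⟩
    · rw [hη x hx, hη' x hx]

open Classical in
/-- A vertex or edge lies in the total star of an end of at most `2 k` edges. -/
theorem card_filter_meets_le {k : ℕ} (hG : G.IsRegularOfDegree k) (x : V ⊕ G.edgeSet) :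
    (Finset.univ.filter fun e : G.edgeSet =>
      ∃ v ∈ (e : Sym2 V), x ∈ G.totalStarFinset v).card ≤ 2 * k := by
  have hinc : ∀ c, (Finset.univ.filter fun e : G.edgeSet => c ∈ (e : Sym2 V)).card = k :=
    fun c => by rw [card_filter_mem_edge, hG.degree_eq]
  rcases x with w | ⟨e', h'⟩
  · refine le_trans (Finset.card_le_card fun e he => ?_) ((hinc w).le.trans (by omega))
    simp only [Finset.mem_filter, Finset.mem_univ, true_and, inl_mem_totalStarFinset] at he ⊢
    obtain ⟨v, hv, rfl⟩ := he
    exact hv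
  · induction e' with
    | _ a b =>
    refine le_trans (Finset.card_le_card (t :=
      (Finset.univ.filter fun e : G.edgeSet => a ∈ (e : Sym2 V)) ∪
      (Finset.univ.filter fun e : G.edgeSet => b ∈ (e : Sym2 V))) fun e he => ?_)
      ((Finset.card_union_le _ _).trans (by rw [hinc, hinc]; omega))
    simp only [Finset.mem_filter, Finset.mem_univ, true_and, inr_mem_totalStarFinset,
      Finset.mem_union] at he ⊢
    obtain ⟨v, hv, hv'⟩ := he
    rcases Sym2.mem_iff.1 hv' with rfl | rfl
    · exact Or.inl hv
    · exact Or.inr hv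

theorem exists_totalDistinguishesBySets_of_pow_le {α : Type*} {k R : ℕ} (hk : 3 ≤ k)
    (hG : G.IsRegularOfDegree k) (L : V ⊕ G.edgeSet → Finset α) (hL : ∀ x, (L x).card = R)
    (hR : 0 < R) (hRk : 8 * (k : ℝ) * ((k : ℝ) - 1) * (fubiniNumber k : ℝ) ≤
      ((R : ℝ) * (((k : ℝ) - 1) / k)) ^ k) :
    ∃ η : V ⊕ G.edgeSet → α, (∀ x, η x ∈ L x) ∧ G.TotalDistinguishesBySets η := by
  classical
  have hkR : (3 : ℝ) ≤ k := by exact_mod_cast hk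
  set q : ℝ := ((k : ℝ) - 1) / k with hq
  have hq0 : 0 < q := div_pos (by linarith) (by linarith)
  let supp : G.edgeSet → Finset (V ⊕ G.edgeSet) := fun e =>
    Finset.univ.filter fun x => ∃ v ∈ (e : Sym2 V), x ∈ G.totalStarFinset v
  let bad : G.edgeSet → (V ⊕ G.edgeSet → α) → Prop := fun e η =>
    ∃ u v, (e : Sym2 V) = s(u, v) ∧
      (G.totalStarFinset u).image η = (G.totalStarFinset v).image η
  have hbad : ∀ (e : G.edgeSet) η u v, (e : Sym2 V) = s(u, v) → bad e η →
      (G.totalStarFinset u).image η = (G.totalStarFinset v).image η := by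
    rintro e η u v he ⟨u', v', he', h⟩
    rcases Sym2.eq_iff.1 (he.symm.trans he') with ⟨rfl, rfl⟩ | ⟨rfl, rfl⟩
    · exact h
    · exact h.symm
  have hmem : ∀ x e, x ∈ supp e ↔ ∃ v ∈ (e : Sym2 V), x ∈ G.totalStarFinset v := fun x e => by
    simp [supp]
  have hends : ∀ e : G.edgeSet, ∃ u v, (e : Sym2 V) = s(u, v) := by
    rintro ⟨e, he⟩
    induction e with
    | _ a b => exact ⟨a, b, rfl⟩
  choose u v he using hends
  -- The bad event is symmetric in the two ends, so either end may be the one relabeled.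
  let W : G.edgeSet → Finset (V ⊕ G.edgeSet) := fun e =>
    (G.totalStarFinset (v e)).erase (Sum.inr e)
  have hu : ∀ e : G.edgeSet, u e ∈ (e : Sym2 V) := fun e => by rw [he e]; exact Sym2.mem_mk_left _ _
  have hv : ∀ e : G.edgeSet, v e ∈ (e : Sym2 V) := fun e => by rw [he e]; exact Sym2.mem_mk_right _ _
  have hWcard : ∀ e, (W e).card = k := by
    intro e
    rw [Finset.card_erase_of_mem ((G.inr_mem_totalStarFinset).2 (hv e)), card_totalStarFinset,
      hG.degree_eq, Nat.add_sub_cancel]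
  set ε : ℝ := (fubiniNumber k : ℝ) / (R : ℝ) ^ k / q ^ k with hε
  have hε0 : 0 ≤ ε := by positivity
  have hε1 : ε * (2 * k) ≤ 1 - q := by
    have h1 : ε * (8 * k * (k - 1)) ≤ 1 := by
      rw [hε, div_div, ← mul_pow, div_mul_eq_mul_div, div_le_one (by positivity)]
      linarith
    have h2 : 1 - q = 1 / k := by
      rw [hq]; field_simp; ring
    rw [h2, le_div_iff₀ (by linarith)]
    nlinarith [mul_nonneg hε0 (by nlinarith : (0 : ℝ) ≤ 8 * k * (k - 1) - 2 * k * k)]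
  obtain ⟨η, hη, hgood⟩ := exists_choice_avoiding (F := fubiniNumber k) hR hL supp bad
    (by
      rintro e η η' h ⟨u, v, he, hb⟩
      refine ⟨u, v, he, ?_⟩
      rw [← Finset.image_congr (f := η), hb, Finset.image_congr]
      · intro x hx
        exact h x ((hmem x e).2 ⟨v, by rw [he]; exact Sym2.mem_mk_right u v, hx⟩)
      · intro x hx
        exact h x ((hmem x e).2 ⟨u, by rw [he]; exact Sym2.mem_mk_left u v, hx⟩))
    (fun e => ⟨Sum.inl (u e), (hmem _ _).2 ⟨u e, hu e, (G.inl_mem_totalStarFinset).2 rfl⟩⟩)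
    W (fun e y hy => (hmem y e).2 ⟨v e, hv e, Finset.mem_of_mem_erase hy⟩)
    (by
      intro e η₀ s hs
      have := G.card_le_of_image_totalStarFinset_eq (he e) η₀ s
        fun η hη => ⟨(hs η hη).1, hbad e η _ _ (he e) (hs η hη).2⟩
      rwa [hG.degree_eq] at this)
    q hq0
    (by
      intro x
      have hcard : (Finset.univ.filter fun e => x ∈ supp e).card ≤ 2 * k := by
        refine le_trans (le_of_eq ?_) (G.card_filter_meets_le hG x)
        simp only [hmem]
      have hcard : ((Finset.univ.filter fun e => x ∈ supp e).card : ℝ) ≤ 2 * k := by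
        exact_mod_cast hcard
      have hq1 : q ≤ 1 := by
        rw [hq, div_le_one (by linarith)]; linarith
      refine (Finset.sum_le_card_nsmul _ _ ε fun e _ => ?_).trans ?_
      · rw [hWcard e, hε]
        -- The exponent of `q` is `k - 1` or `k` according to whether `x ∈ W e`; as `q ≤ 1`, the
        -- bound with `k` covers both.
        exact div_le_div_of_nonneg_left (by positivity) (by positivity)
          (pow_le_pow_of_le_one hq0.le hq1
            ((Finset.card_le_card (Finset.erase_subset _ _)).trans (hWcard e).le))
      · rw [nsmul_eq_mul]
        exact (mul_le_mul_of_nonneg_right hcard hε0).trans (by linarith))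
  refine ⟨η, hη, fun u v huv h => hgood ⟨s(u, v), huv⟩ ⟨u, v, rfl, ?_⟩⟩
  rw [← Finset.coe_inj, Finset.coe_image, Finset.coe_image, coe_totalStarFinset,
    coe_totalStarFinset, h]

end SimpleGraph

/-! ### Size of the Fubini numbers and of the k-th root -/

open Real Finset in
/-- With `c = log 2` one has `∑ i ≥ 1, c ^ i / i! = 1`, so the recursion bounds
`f_n c ^ n / n!`. -/
theorem fubiniNumber_mul_log_two_pow_le (n : ℕ) (hn : 1 ≤ n) :
    (fubiniNumber n : ℝ) * log 2 ^ n / n.factorial ≤ 3 / 4 - 1 / 10 * (1 / 2) ^ n := by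
  have hc1 : 0.6931 < log 2 := lt_trans (by norm_num) log_two_gt_d9
  have hc2 : log 2 < 0.6932 := lt_trans log_two_lt_d9 (by norm_num)
  set c : ℝ := log 2 with hc
  let g : ℕ → ℝ := fun n => (fubiniNumber n : ℝ) * c ^ n / n.factorial
  let p : ℕ → ℝ := fun n => c ^ n / n.factorial
  have hp : ∀ n, 0 ≤ p n := fun n => by positivity
  have h0 := fubiniNumber_zero_le
  have h1 : fubiniNumber 1 ≤ 1 := by
    have := fubiniNumber_le_sum 1 (by norm_num)
    simp at this
    omega
  have h2 : fubiniNumber 2 ≤ 3 := by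
    have := fubiniNumber_le_sum 2 (by norm_num)
    simp [sum_range_succ] at this
    omega
  have hrec : ∀ n, 0 < n → g n ≤ ∑ j ∈ range n, g j * p (n - j) := by
    intro n hn
    have h := fubiniNumber_le_sum n hn
    have h : (fubiniNumber n : ℝ) ≤ ∑ j ∈ range n, (n.choose j : ℝ) * fubiniNumber j := by
      exact_mod_cast h
    calc g n ≤ (∑ j ∈ range n, (n.choose j : ℝ) * fubiniNumber j) * c ^ n / n.factorial := by
          simp only [g]; gcongr
      _ = _ := by
          rw [sum_mul, sum_div]
          refine sum_congr rfl fun j hj => ?_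
          have hj := (mem_range.1 hj).le
          have e : c ^ n = c ^ j * c ^ (n - j) := by rw [← pow_add]; congr 1; omega
          have e2 : (n.factorial : ℝ) = n.choose j * j.factorial * (n - j).factorial := by
            exact_mod_cast (Nat.choose_mul_factorial_mul_factorial hj).symm
          have e3 : (n.choose j : ℝ) ≠ 0 := by exact_mod_cast (Nat.choose_pos hj).ne'
          simp only [g, p]
          rw [e, e2]
          field_simp
  change g n ≤ _
  -- The constant 3/4 lies just above the limit 1/(2 log 2) of `g`. The term `g 0`, bounded only by
  -- 1, contributes an excess `p n / 4`. The correction `(1 / 2) ^ n / 10` absorbs it: the recursion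
  -- multiplies it by a partial sum of ∑ 2^i c^i/i! = e^(2c) - 1 = 3, which exceeds 1.
  induction n using Nat.strong_induction_on with
  | _ n ih =>
  obtain rfl | rfl | hn3 : n = 1 ∨ n = 2 ∨ 3 ≤ n := by omega
  · have : (fubiniNumber 1 : ℝ) ≤ 1 := by exact_mod_cast h1
    simp only [g, pow_one, Nat.factorial_one, Nat.cast_one, div_one]
    nlinarith
  · have : (fubiniNumber 2 : ℝ) ≤ 3 := by exact_mod_cast h2
    simp only [g, Nat.factorial_two, Nat.cast_ofNat]
    nlinarith
  · obtain ⟨m, rfl⟩ : ∃ m, n = m + 1 := ⟨n - 1, by omega⟩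
    have hm : 2 ≤ m := by omega
    have hg0 : g 0 ≤ 1 := by
      simp only [g, pow_zero, Nat.factorial_zero, Nat.cast_one, div_one, mul_one]
      exact_mod_cast h0
    have hstep : g (m + 1) ≤ p (m + 1) +
        ∑ j ∈ range m, (3 / 4 - 1 / 10 * (1 / 2) ^ (j + 1)) * p (m - j) := by
      refine (hrec (m + 1) (by omega)).trans ?_
      rw [sum_range_succ', add_comm]
      refine add_le_add ?_ (sum_le_sum fun j hj => ?_)
      · simpa using mul_le_mul_of_nonneg_right hg0 (hp (m + 1))
      · have hj := mem_range.1 hj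
        rw [show m + 1 - (j + 1) = m - j by omega]
        exact mul_le_mul_of_nonneg_right (ih (j + 1) (by omega) (by omega)) (hp _)
    have hrefl : ∑ j ∈ range m, (3 / 4 - 1 / 10 * (1 / 2) ^ (j + 1)) * p (m - j) =
        3 / 4 * ∑ i ∈ range m, p (i + 1) -
          1 / 10 * (1 / 2) ^ (m + 1) * ∑ i ∈ range m, 2 ^ (i + 1) * p (i + 1) := by
      rw [← sum_range_reflect, mul_sum, mul_sum, ← sum_sub_distrib]
      refine sum_congr rfl fun i hi => ?_
      have hi := mem_range.1 hi
      rw [show m - (m - 1 - i) = i + 1 by omega, show m - 1 - i + 1 = m - i by omega]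
      have : ((1 : ℝ) / 2) ^ (m + 1) * 2 ^ (i + 1) = (1 / 2) ^ (m - i) := by
        rw [show m + 1 = (m - i) + (i + 1) by omega, pow_add, mul_assoc, ← mul_pow]
        norm_num
      rw [← this]
      ring
    have hsum : ∑ i ∈ range m, p (i + 1) ≤ 1 - p (m + 1) := by
      have h := Real.sum_le_exp_of_nonneg (x := c) (by linarith) (m + 2)
      rw [hc, exp_log (by norm_num), ← hc, sum_range_succ', sum_range_succ] at h
      simp only [pow_zero, Nat.factorial_zero, Nat.cast_one, div_one] at h
      change ∑ i ∈ range m, p (i + 1) + p (m + 1) + 1 ≤ 2 at h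
      linarith
    -- The first two terms, 2c + 2c², suffice.
    have hsum2 : 2.346 ≤ ∑ i ∈ range m, 2 ^ (i + 1) * p (i + 1) := by
      refine le_trans ?_ (sum_le_sum_of_subset_of_nonneg
        (range_subset_range.2 hm) fun i _ _ => mul_nonneg (by positivity) (hp _))
      simp only [sum_range_succ, range_zero, sum_empty, p]
      norm_num [Nat.factorial]
      nlinarith
    -- The constant comes from 8c³/6 at `m = 2`; afterwards `p` at least halves at each step.
    have hpm : ∀ m, 2 ≤ m → p (m + 1) ≤ 0.4442 * (1 / 2) ^ (m + 1) := by
      intro m hm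
      induction m, hm using Nat.le_induction with
      | base =>
        simp only [p]
        norm_num [Nat.factorial]
        have : c ^ 3 ≤ 0.6932 ^ 3 := by gcongr
        norm_num at this
        linarith
      | succ m hm ih =>
        have e : p (m + 1 + 1) = p (m + 1) * (c / (m + 2)) := by
          simp only [p]
          rw [Nat.factorial_succ (m + 1), pow_succ]
          push_cast
          rw [show (m : ℝ) + 1 + 1 = m + 2 by ring]
          field_simp
        have hm' : (2 : ℝ) ≤ m := by exact_mod_cast hm
        have : c / (m + 2) ≤ 1 / 2 := by
          rw [div_le_iff₀ (by linarith)]; linarith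
        rw [e, pow_succ _ (m + 1), ← mul_assoc]
        exact mul_le_mul ih this (by positivity) (by positivity)
    have hpm := hpm m hm
    have hq : (0 : ℝ) < (1 / 2) ^ (m + 1) := by positivity
    rw [hrefl] at hstep
    nlinarith

open Real in
-- Stirling's sequence decreases, so its first value bounds it.
theorem factorial_le_stirling (n : ℕ) (hn : 1 ≤ n) :
    (n.factorial : ℝ) ≤ exp 1 * √n * (n / exp 1) ^ n := by
  obtain ⟨m, rfl⟩ : ∃ m, n = m + 1 := ⟨n - 1, by omega⟩
  have h : Stirling.stirlingSeq (m + 1) ≤ Stirling.stirlingSeq 1 :=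
    Stirling.stirlingSeq'_antitone (Nat.zero_le m)
  rw [Stirling.stirlingSeq_one, Stirling.stirlingSeq, div_le_iff₀ (by positivity),
    Real.sqrt_mul (by norm_num)] at h
  refine h.trans (le_of_eq ?_)
  field_simp

open Real in
-- Tangent at 1600, where log 1600 - 1 < 6.378; log 5 is controlled by 5³ = 125 against 2⁷ = 128.
theorem log_le_tangent_1600 (x : ℝ) (hx : 0 < x) : log x ≤ x / 1600 + 6.378 := by
  have h1 : log (x / 1600) ≤ x / 1600 - 1 := log_le_sub_one_of_pos (by positivity)
  rw [log_div hx.ne' (by norm_num)] at h1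
  have h5 : 3 * log 5 ≤ 7 * log 2 - 3 / 128 := by
    have : log (125 / 128) ≤ 125 / 128 - 1 := log_le_sub_one_of_pos (by norm_num)
    rw [log_div (by norm_num) (by norm_num), show (125 : ℝ) = 5 ^ 3 by norm_num,
      show (128 : ℝ) = 2 ^ 7 by norm_num, log_pow, log_pow] at this
    push_cast at this
    linarith
  have h : log 1600 = 6 * log 2 + 2 * log 5 := by
    rw [show (1600 : ℝ) = 2 ^ 6 * 5 ^ 2 by norm_num, log_mul (by norm_num) (by norm_num),
      log_pow, log_pow]
    push_cast
    ring
  have := log_two_lt_d9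
  linarith

open Real in
theorem log_six_lt : log 6 < 1.793 := by
  have h : log (243 / 256) ≤ 243 / 256 - 1 := log_le_sub_one_of_pos (by norm_num)
  rw [log_div (by norm_num) (by norm_num), show (243 : ℝ) = 3 ^ 5 by norm_num,
    show (256 : ℝ) = 2 ^ 8 by norm_num, log_pow, log_pow] at h
  have h6 : log 6 = log 2 + log 3 := by
    rw [← log_mul (by norm_num) (by norm_num)]; norm_num
  have := log_two_lt_d9
  push_cast at h
  linarith

open Real in
theorem rpow_fubiniNumber_le (k : ℕ) (hk : 1600 ≤ k) :
    (8 * (k : ℝ) * ((k : ℝ) - 1) * (fubiniNumber k : ℝ)) ^ (1 / (k : ℝ)) ≤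
      0.53157 * (k + 18.74 + 176.65 / k) := by
  have hkR : (1600 : ℝ) ≤ k := by exact_mod_cast hk
  have hk0 : (0 : ℝ) < k := by linarith
  have hc1 : 0.69314718 < log 2 := lt_trans (by norm_num) log_two_gt_d9
  have he1 : 2.7182818 < exp 1 := lt_trans (by norm_num) exp_one_gt_d9
  have hf : (fubiniNumber k : ℝ) ≤ 3 / 4 * k.factorial / log 2 ^ k := by
    have h := fubiniNumber_mul_log_two_pow_le k (by omega)
    rw [div_le_iff₀ (by positivity)] at h
    rw [le_div_iff₀ (by positivity)]
    refine h.trans (mul_le_mul_of_nonneg_right ?_ (by positivity))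
    linarith [show (0 : ℝ) < (1 / 2) ^ k by positivity]
  have hst := factorial_le_stirling k (by omega)
  have hZ : 8 * (k : ℝ) * ((k : ℝ) - 1) * (fubiniNumber k : ℝ) ≤
      6 * k ^ 2 * (exp 1 * √k) * (k / (exp 1 * log 2)) ^ k := by
    calc 8 * (k : ℝ) * ((k : ℝ) - 1) * (fubiniNumber k : ℝ)
        ≤ 8 * (k : ℝ) * k * (3 / 4 * (exp 1 * √k * (k / exp 1) ^ k) / log 2 ^ k) := by
          gcongr
          · linarith
          · exact hf.trans (by gcongr)
      _ = _ := by
          rw [← div_div, div_pow (_ / _)]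
          ring
  -- Here 18.74 bounds log 6 + 1 + (5/2) · 6.378, and 1/640 = (5/2)/1600.
  have hlog : log (6 * k ^ 2 * (exp 1 * √k)) ≤ k * (18.74 / k + 1 / 640) := by
    have e : log (6 * k ^ 2 * (exp 1 * √k)) = log 6 + 1 + 5 / 2 * log k := by
      rw [log_mul (by positivity) (by positivity), log_mul (by positivity) (by positivity),
        log_mul (by positivity) (by positivity), log_pow, log_exp, log_sqrt hk0.le]
      push_cast
      ring
    rw [e, mul_add, mul_div_cancel₀ _ hk0.ne']
    have := log_le_tangent_1600 k hk0
    have := log_six_lt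
    linarith
  have hY : (8 * (k : ℝ) * ((k : ℝ) - 1) * (fubiniNumber k : ℝ)) ^ (1 / (k : ℝ)) ≤
      exp (18.74 / k + 1 / 640) * (k / (exp 1 * log 2)) := by
    have h : 8 * (k : ℝ) * ((k : ℝ) - 1) * (fubiniNumber k : ℝ) ≤
        (exp (18.74 / k + 1 / 640) * (k / (exp 1 * log 2))) ^ k := by
      refine hZ.trans ?_
      rw [mul_pow, ← exp_nat_mul]
      gcongr
      rwa [← log_le_iff_le_exp (by positivity)]
    refine (rpow_le_rpow ?_ h (by positivity)).trans (le_of_eq ?_)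
    · have : (0 : ℝ) ≤ (k : ℝ) - 1 := by linarith
      positivity
    · rw [← rpow_natCast, ← rpow_mul (by positivity), mul_one_div_cancel hk0.ne', rpow_one]
  have hexp : ∀ x : ℝ, 0 ≤ x → x ≤ 1 / 80 → exp x ≤ 1 + x + 0.503 * x ^ 2 := by
    intro x hx0 hx1
    have h := exp_bound' hx0 (by linarith) (n := 3) (by norm_num)
    simp only [Finset.sum_range_succ, Finset.range_zero, Finset.sum_empty] at h
    norm_num [Nat.factorial] at h
    have : x ^ 3 ≤ x ^ 2 * (1 / 80) := by rw [pow_succ]; gcongr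
    nlinarith [sq_nonneg x]
  have h1 : exp (1 / 640) ≤ 1.00156373 := by
    refine (hexp _ (by norm_num) (by norm_num)).trans (by norm_num)
  -- 176.65 bounds 0.503 · 18.74².
  have h2 : exp (18.74 / k) ≤ 1 + 18.74 / k + 176.65 / k ^ 2 := by
    refine (hexp _ (by positivity) ?_).trans ?_
    · rw [div_le_iff₀ hk0]; linarith
    · rw [div_pow, ← mul_div_assoc]
      gcongr
      norm_num
  have h3 : exp (1 / 640) / (exp 1 * log 2) ≤ 0.53157 := by
    rw [div_le_iff₀ (by positivity)]
    nlinarith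
  calc _ ≤ _ := hY
    _ = exp (1 / 640) / (exp 1 * log 2) * (k * exp (18.74 / k)) := by
        rw [exp_add]; ring
    _ ≤ 0.53157 * (k * (1 + 18.74 / k + 176.65 / k ^ 2)) := by gcongr
    _ = _ := by field_simp

/-! ### The list size -/

theorem totalListSize_le_of_large (k : ℕ) (hk : 1600 ≤ k) :
    (totalListSize k : ℝ) ≤ 0.54 * (k : ℝ) := by
  have hkR : (1600 : ℝ) ≤ k := by exact_mod_cast hk
  have hY := rpow_fubiniNumber_le k hk
  set Y : ℝ := (8 * (k : ℝ) * ((k : ℝ) - 1) * (fubiniNumber k : ℝ)) ^ (1 / (k : ℝ)) with hYdef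
  have hX : 2 + (k : ℝ) / ((k : ℝ) - 1) * Y ≤ 0.53158 * k + 12.57 := by
    have hY' : (k : ℝ) / ((k : ℝ) - 1) * Y ≤
        (k : ℝ) / ((k : ℝ) - 1) * (0.53157 * (k + 18.74 + 176.65 / k)) := by
      have : (0 : ℝ) ≤ (k : ℝ) - 1 := by linarith
      gcongr
    have e : (k : ℝ) / ((k : ℝ) - 1) * (0.53157 * (k + 18.74 + 176.65 / k)) =
        0.53157 * (k ^ 2 + 18.74 * k + 176.65) / ((k : ℝ) - 1) := by
      have : (k : ℝ) - 1 ≠ 0 := by linarith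
      have : (k : ℝ) ≠ 0 := by linarith
      field_simp
    have : 0.53157 * ((k : ℝ) ^ 2 + 18.74 * k + 176.65) / ((k : ℝ) - 1) ≤
        0.53157 * k + 10.5695 := by
      rw [div_le_iff₀ (by linarith)]
      nlinarith
    linarith
  -- The ceiling must be compared with the integer part of 0.54 k.
  have hceil : totalListSize k ≤ 54 * k / 100 := by
    refine Nat.ceil_le.2 (hX.trans ?_)
    by_cases h : k ≤ 1609
    · interval_cases k <;> norm_num
    · have h1 : 54 * k ≤ 100 * (54 * k / 100) + 98 := by omega
      have h1 : 54 * (k : ℝ) ≤ 100 * ((54 * k / 100 : ℕ) : ℝ) + 98 := by exact_mod_cast h1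
      have h2 : (1610 : ℝ) ≤ k := by exact_mod_cast (by omega : 1610 ≤ k)
      linarith
  have h : ((54 * k / 100 : ℕ) : ℝ) ≤ 54 * k / 100 := by
    refine Nat.cast_div_le.trans ?_
    push_cast
    exact le_rfl
  have : (totalListSize k : ℝ) ≤ ((54 * k / 100 : ℕ) : ℝ) := by exact_mod_cast hceil
  linarith

theorem totalListSize_pos (k : ℕ) (hk : 1 < k) : 0 < totalListSize k := by
  have : (1 : ℝ) < k := by exact_mod_cast hk
  have : (0 : ℝ) < (k : ℝ) - 1 := by linarith
  exact Nat.ceil_pos.2 (by positivity)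

theorem le_totalListSize_mul_pow (k : ℕ) (hk : 1 < k) :
    8 * (k : ℝ) * ((k : ℝ) - 1) * (fubiniNumber k : ℝ) ≤
      ((totalListSize k : ℝ) * (((k : ℝ) - 1) / k)) ^ k := by
  have hk1 : (1 : ℝ) < k := by exact_mod_cast hk
  have hk2 : (0 : ℝ) < (k : ℝ) - 1 := by linarith
  set Z : ℝ := 8 * (k : ℝ) * ((k : ℝ) - 1) * (fubiniNumber k : ℝ) with hZ
  have hZ0 : 0 ≤ Z := by positivity
  have h : 2 + (k : ℝ) / ((k : ℝ) - 1) * Z ^ (1 / (k : ℝ)) ≤ totalListSize k := Nat.le_ceil _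
  calc Z = (Z ^ (1 / (k : ℝ))) ^ k := by
        rw [← Real.rpow_natCast, ← Real.rpow_mul hZ0, one_div_mul_cancel (by positivity),
          Real.rpow_one]
    _ ≤ _ := by
        gcongr
        rw [← mul_div_assoc, le_div_iff₀ (by positivity)]
        have h : (k : ℝ) / ((k : ℝ) - 1) * Z ^ (1 / (k : ℝ)) ≤ totalListSize k := by linarith
        rw [div_mul_eq_mul_div, div_le_iff₀ hk2] at h
        linarith

theorem corollary4p2 (k : ℕ) (hk : 3 ≤ k) :
    (∀ (V : Type*) [Fintype V] (G : SimpleGraph V) [DecidableRel G.Adj] (α : Type*)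
        (L : V ⊕ G.edgeSet → Finset α),
      G.IsRegularOfDegree k →
      (∀ x, totalListSize k ≤ (L x).card) →
      ∃ η : V ⊕ G.edgeSet → α, (∀ x, η x ∈ L x) ∧ G.TotalDistinguishesBySets η) ∧
    (1600 ≤ k → (totalListSize k : ℝ) ≤ 0.54 * (k : ℝ)) := by
  refine ⟨?_, totalListSize_le_of_large k⟩
  intro V _ G _ α L hG hL
  -- The counting argument needs all lists of exactly the same size.
  choose L' hsub hcard using fun x => Finset.exists_subset_card_eq (hL x)
  obtain ⟨η, hη, hd⟩ := G.exists_totalDistinguishesBySets_of_pow_le hk hG L' hcard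
    (totalListSize_pos k (by omega)) (le_totalListSize_mul_pow k (by omega))
  exact ⟨η, fun x => hsub x (hη x), hd⟩
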